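/- Let $D\in\mathbb{R}^{n\times N}$ be a tight frame in the sense that $DD^*=I_n$, let $s>0$ be a real number, and let $$\mathcal{K}_s=\{f\in\mathbb{R}^n:\ \|f\|_2=1,\ \|D^*f\|_1\le\sqrt{s}\,\|D^*f\|_2\}$$ be the set of $\ell_2$-normalized effectively $s$-analysis-sparse signals. For $K\subseteq\mathbb{R}^n$ let $w(K)=\mathbb{E}\big[\sup_{f\in K}\langle f,g\rangle\big]$, where $g\in\mathbb{R}^n$ is a standard normal random vector, be its Gaussian width (with $\sup\emptyset=0$), and for $\rho>0$ let $\mathcal{N}(K,\rho)$ be its covering number, i.e. the smallest number of closed Euclidean balls of radius $\rho$ with centers in $K$ that cover $K$. Then there is an absolute constant $C>0$ (independent of $n$, $N$, $D$, $s$) such that: (i) if $s\le N$, then $g\mapsto\sup_{f\in\mathcal{K}_s}\langle f,g\rangle$ is integrable and $$w(\mathcal{K}_s)\le C\sqrt{s\ln(eN/s)};$$ (ii) for every $\rho>0$ such that $t:=\lceil 4\rho^{-2}s\rceil$ satisfies $t\le N$, $$\mathcal{N}(\mathcal{K}_s,\rho)\le\binom{N}{t}\left(1+\frac{8}{\rho}\right)^t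 .$$ -/

import Mathlib

open MeasureTheory ProbabilityTheory
open scoped NNReal ENNReal Matrix

noncomputable section

/-- A real `n × N` dictionary is a (Parseval) tight frame when `D D* = I_n`. -/
def IsTightFrame {n N : ℕ} (D : Matrix (Fin n) (Fin N) ℝ) : Prop :=
  D * Dᵀ = 1

/-- The effectively `s`-sparse coefficient vectors of `ℝ^N`: `‖x‖₁ ≤ √s ‖x‖₂`. -/
def effSparse (N : ℕ) (s : ℝ) : Set (EuclideanSpace ℝ (Fin N)) :=
  {x | ∑ i, |x i| ≤ √s * ‖x‖}

/-- The effectively `s`-analysis-sparse signals: the preimage of `effSparse N s` under `D*`. -/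
def effAnalysisSparse {n N : ℕ} (D : Matrix (Fin n) (Fin N) ℝ) (s : ℝ) :
    Set (EuclideanSpace ℝ (Fin n)) :=
  (fun f => Matrix.toEuclideanLin Dᵀ f) ⁻¹' effSparse N s

/-- The `ℓ₂`-normalized effectively `s`-analysis-sparse signals. -/
def unitEffAnalysisSparse {n N : ℕ} (D : Matrix (Fin n) (Fin N) ℝ) (s : ℝ) :
    Set (EuclideanSpace ℝ (Fin n)) :=
  effAnalysisSparse D s ∩ Metric.sphere 0 1

/-- `sup_{f ∈ K} ⟨f, g⟩`, equal to `0` when `K` is empty. -/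
def supInner {n : ℕ} (K : Set (EuclideanSpace ℝ (Fin n))) (g : EuclideanSpace ℝ (Fin n)) : ℝ :=
  sSup ((fun f => inner ℝ f g) '' K)

/-- The Gaussian width `w(K) = 𝔼 sup_{f ∈ K} ⟨f, g⟩`, for a standard normal vector `g` in `ℝ^n`. -/
def gaussianWidth {n : ℕ} (K : Set (EuclideanSpace ℝ (Fin n))) : ℝ :=
  ∫ g, supInner K g ∂(stdGaussian (EuclideanSpace ℝ (Fin n)))

end

/-!
Since `D D* = 1`, the analysis operator `D*` is an isometry that sends the signals of `K_s` into the
`ℓ₁` ball of radius `√s` inside the `ℓ₂` unit ball of coefficient space, and both bounds hold for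
any set that a linear isometry maps into this intersection `B`.

For the width, let `x ∈ B` and split each Gaussian coefficient `h i` at the threshold
`l = √(2 ln (e N / s))`. The part of size at most `l` contributes at most `‖x‖₁ l ≤ √s l`; the
excess contributes at most `√s / 2 + (2 √s)⁻¹ ∑ i, (|h i| - l)⁺ ^ 2`, a sum whose mean is of order
`N exp (-l² / 2) = s / e`.

For the covering number, keeping the `t` largest coordinates of `x ∈ B` makes an `ℓ₂` error of at
most `‖x‖₁ / (2 √t) ≤ ρ / 4`. The kept part lies in one of `N.choose t` unit balls of dimension `t`,
each with a `ρ / 4`-net of at most `(1 + 8 / ρ) ^ t` points. This covers `B` with radius `ρ / 2`,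
and moving the centers into the set at most doubles the radius.
-/

section CoveringNumbers

open Metric

theorem externalCoveringNumber_add_le_of_isCover {X : Type*} [PseudoEMetricSpace X] {A B : Set X}
    {δ : ℝ≥0} (h : IsCover δ A B) (ε : ℝ≥0) :
    externalCoveringNumber (δ + ε) A ≤ externalCoveringNumber ε B := by
  refine le_iInf₂ fun C hC => IsCover.externalCoveringNumber_le_encard fun a ha => ?_
  obtain ⟨b, hb, hab⟩ := h ha
  obtain ⟨c, hc, hbc⟩ := hC hb
  refine ⟨c, hc, (edist_triangle a b c).trans ?_⟩
  push_cast
  exact add_le_add hab hbc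

theorem exists_isCover_encard_eq_externalCoveringNumber {X : Type*} [PseudoEMetricSpace X]
    (ε : ℝ≥0) (A : Set X) : ∃ C, IsCover ε A C ∧ C.encard = externalCoveringNumber ε A := by
  have : Nonempty {C : Set X // IsCover ε A C} := ⟨A, .rfl⟩
  obtain ⟨⟨C, hC⟩, hcard⟩ := ciInf_mem fun C : {C : Set X // IsCover ε A C} => C.1.encard
  exact ⟨C, hC, hcard.trans iInf_subtype⟩

theorem externalCoveringNumber_biUnion_le {X κ : Type*} [PseudoEMetricSpace X] (ε : ℝ≥0)
    (T : Finset κ) (A : κ → Set X) :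
    externalCoveringNumber ε (⋃ k ∈ T, A k) ≤ ∑ k ∈ T, externalCoveringNumber ε (A k) := by
  choose C hC hcard using fun k => exists_isCover_encard_eq_externalCoveringNumber ε (A k)
  have hcover : IsCover ε (⋃ k ∈ T, A k) (⋃ k ∈ T, C k) := fun x hx => by
    obtain ⟨k, hk, hxk⟩ := Set.mem_iUnion₂.1 hx
    obtain ⟨y, hy, hxy⟩ := hC k hxk
    exact ⟨y, Set.mem_biUnion hk hy, hxy⟩
  calc externalCoveringNumber ε (⋃ k ∈ T, A k)
      ≤ (⋃ k ∈ T, C k).encard := hcover.externalCoveringNumber_le_encard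
    _ ≤ ∑ k ∈ T, (C k).encard := T.set_encard_biUnion_le C
    _ = ∑ k ∈ T, externalCoveringNumber ε (A k) := Finset.sum_congr rfl fun k _ => hcard k

variable {E : Type*} [NormedAddCommGroup E] [NormedSpace ℝ E]

theorem encard_le_of_isSeparated_of_subset_closedBall [FiniteDimensional ℝ E] {ε R : ℝ≥0}
    (hε : 0 < ε) {x : E} {C : Set E} (hC : C ⊆ closedBall x R) (hsep : IsSeparated ε C) :
    (C.encard : ℝ≥0∞) ≤ ((1 + 2 * R / ε) ^ Module.finrank ℝ E : ℝ≥0) := by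
  borelize E
  let μ : Measure E := Measure.addHaar
  set d := Module.finrank ℝ E
  have hμball : ∀ (y : E) {r : ℝ≥0}, 0 < r → μ (ball y r) = (r ^ d : ℝ≥0) * μ (ball 0 1) :=
    fun y r hr => by
      rw [μ.addHaar_ball_of_pos y (NNReal.coe_pos.2 hr), ← NNReal.coe_pow,
        ENNReal.ofReal_coe_nnreal]
  have hdisj : Pairwise (Function.onFun Disjoint fun c : C => ball (c : E) (ε / 2 : ℝ≥0)) := by
    intro c c' hcc'
    apply ball_disjoint_ball
    have hlt : (ε : ℝ≥0∞) < edist (c : E) c' := hsep c.2 c'.2 (Subtype.coe_injective.ne hcc')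
    rw [edist_nndist, ENNReal.coe_lt_coe] at hlt
    rw [← NNReal.coe_add, add_halves]
    exact hlt.le
  have hsub : ⋃ c : C, ball (c : E) (ε / 2 : ℝ≥0) ⊆ ball x (R + ε / 2 : ℝ≥0) := by
    refine Set.iUnion_subset fun c => ball_subset_ball' ?_
    rw [NNReal.coe_add, add_comm]
    gcongr
    exact hC c.2
  have hvol : (C.encard : ℝ≥0∞) * ((ε / 2) ^ d : ℝ≥0) * μ (ball 0 1)
      ≤ ((R + ε / 2) ^ d : ℝ≥0) * μ (ball 0 1) := by
    calc (C.encard : ℝ≥0∞) * ((ε / 2) ^ d : ℝ≥0) * μ (ball 0 1)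
        = ∑' c : C, μ (ball (c : E) (ε / 2 : ℝ≥0)) := by
          simp only [hμball _ (half_pos hε), ENNReal.tsum_const, Set.encard, mul_assoc]
      _ ≤ μ (⋃ c : C, ball (c : E) (ε / 2 : ℝ≥0)) :=
          tsum_meas_le_meas_iUnion_of_disjoint μ (fun _ => measurableSet_ball) hdisj
      _ ≤ μ (ball x (R + ε / 2 : ℝ≥0)) := measure_mono hsub
      _ = _ := hμball x (by positivity)
  have hratio : 1 + 2 * R / ε = (R + ε / 2) / (ε / 2) := by
    field_simp
    ring
  rw [ENNReal.mul_le_mul_iff_left (measure_ball_pos μ 0 one_pos).ne' measure_ball_lt_top.ne]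
    at hvol
  rw [hratio, div_pow, ENNReal.coe_div (by positivity)]
  exact ENNReal.le_div_iff_mul_le (.inl (by simp [hε.ne'])) (.inl ENNReal.coe_ne_top) |>.2 hvol

theorem coveringNumber_closedBall_le [FiniteDimensional ℝ E] {ε : ℝ≥0} (hε : 0 < ε) (x : E)
    (R : ℝ≥0) :
    (coveringNumber ε (closedBall x R) : ℝ≥0∞) ≤
      ((1 + 2 * R / ε) ^ Module.finrank ℝ E : ℝ≥0) := by
  refine (ENat.toENNReal_le.2 (coveringNumber_le_packingNumber ε _)).trans ?_
  simp only [packingNumber, ENat.toENNReal_iSup]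
  exact iSup_le fun C => iSup₂_le fun hC hsep =>
    encard_le_of_isSeparated_of_subset_closedBall hε hC hsep

theorem coveringNumber_submodule_inter_closedBall_le (V : Submodule ℝ E) [FiniteDimensional ℝ V]
    {ε : ℝ≥0} (hε : 0 < ε) (R : ℝ≥0) :
    (coveringNumber ε ((V : Set E) ∩ closedBall 0 R) : ℝ≥0∞) ≤
      ((1 + 2 * R / ε) ^ Module.finrank ℝ V : ℝ≥0) := by
  have himage : V.subtypeₗᵢ '' closedBall 0 R = (V : Set E) ∩ closedBall 0 R := by
    ext v
    simp [and_comm]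
  rw [← himage, V.subtypeₗᵢ.isometry.coveringNumber_image]
  exact coveringNumber_closedBall_le hε 0 R

end CoveringNumbers

section Sparsity

variable {ι : Type*}

theorem exists_card_eq_forall_notMem_le {α : Type*} [Fintype ι] [LinearOrder α] (a : ι → α) {t : ℕ}
    (ht : t ≤ Fintype.card ι) : ∃ S : Finset ι, S.card = t ∧ ∀ i ∈ S, ∀ j ∉ S, a j ≤ a i := by
  classical
  induction t with
  | zero => exact ⟨∅, by simp⟩
  | succ t ih =>
    obtain ⟨S, hS, hle⟩ := ih (by omega)
    have hne : (Sᶜ).Nonempty := by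
      rw [← Finset.card_pos, Finset.card_compl]
      omega
    obtain ⟨k, hk, hmax⟩ := Finset.exists_max_image Sᶜ a hne
    simp only [Finset.mem_compl] at hk hmax
    refine ⟨insert k S, by rw [Finset.card_insert_of_notMem hk, hS], fun i hi j hj => ?_⟩
    rw [Finset.mem_insert, not_or] at hj
    rcases Finset.mem_insert.1 hi with rfl | hi
    · exact hmax j hj.2
    · exact hle i hi j hj.2

theorem exists_card_eq_sum_compl_sq_le [Fintype ι] [DecidableEq ι] (x : ι → ℝ) {t : ℕ}
    (ht : t ≤ Fintype.card ι) :
    ∃ S : Finset ι, S.card = t ∧ 4 * t * ∑ i ∈ Sᶜ, x i ^ 2 ≤ (∑ i, |x i|) ^ 2 := by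
  obtain ⟨S, hS, hle⟩ := exists_card_eq_forall_notMem_le (fun i => |x i|) ht
  refine ⟨S, hS, ?_⟩
  have htail : t * ∑ i ∈ Sᶜ, x i ^ 2 ≤ (∑ i ∈ S, |x i|) * ∑ i ∈ Sᶜ, |x i| := by
    rw [Finset.mul_sum, Finset.mul_sum]
    refine Finset.sum_le_sum fun j hj => ?_
    have hj' : t * |x j| ≤ ∑ i ∈ S, |x i| := by
      rw [← hS, ← nsmul_eq_mul]
      exact Finset.card_nsmul_le_sum _ _ _ fun i hi => hle i hi j (Finset.mem_compl.1 hj)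
    rw [← sq_abs, sq, ← mul_assoc]
    exact mul_le_mul_of_nonneg_right hj' (abs_nonneg _)
  calc 4 * t * ∑ i ∈ Sᶜ, x i ^ 2
      ≤ 4 * (∑ i ∈ S, |x i|) * ∑ i ∈ Sᶜ, |x i| := by linarith
    _ ≤ (∑ i ∈ S, |x i| + ∑ i ∈ Sᶜ, |x i|) ^ 2 := four_mul_le_sq_add _ _
    _ = (∑ i, |x i|) ^ 2 := by rw [Finset.sum_add_sum_compl]

/-- The subspace of `ℝ^ι` of the vectors supported on `S`. -/
def supportedOn (S : Finset ι) : Submodule ℝ (EuclideanSpace ℝ ι) where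
  carrier := {x | ∀ i ∉ S, x i = 0}
  add_mem' hx hy i hi := by simp [hx i hi, hy i hi]
  zero_mem' i _ := by simp
  smul_mem' c x hx i hi := by simp [hx i hi]

/-- The restriction of a vector to the coordinates in `S`, extended by zero. -/
noncomputable def truncate [DecidableEq ι] (S : Finset ι) (x : EuclideanSpace ℝ ι) :
    EuclideanSpace ℝ ι :=
  WithLp.toLp 2 fun i => if i ∈ S then x i else 0

theorem truncate_mem_supportedOn [DecidableEq ι] (S : Finset ι) (x : EuclideanSpace ℝ ι) :
    truncate S x ∈ supportedOn S := fun i hi => by simp [truncate, hi]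

theorem finrank_supportedOn_le (S : Finset ι) :
    Module.finrank ℝ (supportedOn S) ≤ S.card := by
  let restrict : supportedOn S →ₗ[ℝ] S → ℝ :=
    { toFun := fun x i => x.1 i
      map_add' := fun _ _ => rfl
      map_smul' := fun _ _ => rfl }
  have hinj : Function.Injective restrict := fun x y hxy => by
    ext i
    by_cases hi : i ∈ S
    · exact congrFun hxy ⟨i, hi⟩
    · rw [x.2 i hi, y.2 i hi]
  simpa using LinearMap.finrank_le_finrank_of_injective hinj

theorem norm_truncate_sq [Fintype ι] [DecidableEq ι] (S : Finset ι) (x : EuclideanSpace ℝ ι) :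
    ‖truncate S x‖ ^ 2 = ∑ i ∈ S, x i ^ 2 := by
  simp [EuclideanSpace.real_norm_sq_eq, truncate, ite_pow]

theorem truncate_add_truncate_compl [Fintype ι] [DecidableEq ι] (S : Finset ι)
    (x : EuclideanSpace ℝ ι) : truncate S x + truncate Sᶜ x = x := by
  ext i
  by_cases hi : i ∈ S <;> simp [truncate, hi]

theorem norm_truncate_le [Fintype ι] [DecidableEq ι] (S : Finset ι) (x : EuclideanSpace ℝ ι) :
    ‖truncate S x‖ ≤ ‖x‖ := by
  rw [← sq_le_sq₀ (norm_nonneg _) (norm_nonneg _), norm_truncate_sq, EuclideanSpace.real_norm_sq_eq]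
  exact Finset.sum_le_univ_sum_of_nonneg fun i => sq_nonneg _

/-- The intersection of the `ℓ₂` unit ball and the `ℓ₁` ball of radius `r`, a convex
model of the unit vectors with at most `r ^ 2` nonzero coordinates. -/
def l1l2Ball (ι : Type*) [Fintype ι] (r : ℝ) : Set (EuclideanSpace ℝ ι) :=
  {x | ‖x‖ ≤ 1 ∧ ∑ i, |x i| ≤ r}

open Metric

theorem isCover_l1l2Ball [Fintype ι] {r : ℝ} {δ : ℝ≥0} {t : ℕ} (ht0 : t ≠ 0)
    (hrt : r ^ 2 ≤ 4 * t * δ ^ 2) (ht : t ≤ Fintype.card ι) :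
    IsCover δ (l1l2Ball ι r) (⋃ S ∈ (Finset.univ : Finset ι).powersetCard t,
      (supportedOn S : Set (EuclideanSpace ℝ ι)) ∩ closedBall 0 1) := by
  classical
  rintro x ⟨hx2, hx1⟩
  obtain ⟨S, hS, htail⟩ := exists_card_eq_sum_compl_sq_le x ht
  have hball : truncate S x ∈ closedBall 0 1 :=
    mem_closedBall_zero_iff.2 ((norm_truncate_le S x).trans hx2)
  refine ⟨truncate S x, Set.mem_biUnion (Finset.mem_powersetCard_univ.2 hS)
    ⟨truncate_mem_supportedOn S x, hball⟩, ?_⟩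
  have hdist : dist x (truncate S x) = ‖truncate Sᶜ x‖ := by
    rw [dist_eq_norm, sub_eq_of_eq_add' (truncate_add_truncate_compl S x).symm]
  have hle : 4 * t * ‖truncate Sᶜ x‖ ^ 2 ≤ 4 * t * (δ : ℝ) ^ 2 := by
    rw [norm_truncate_sq]
    refine htail.trans (le_trans ?_ hrt)
    gcongr
  have hnorm : ‖truncate Sᶜ x‖ ≤ δ := by
    refine (sq_le_sq₀ (norm_nonneg _) δ.2).1 (le_of_mul_le_mul_left hle ?_)
    positivity
  change edist _ _ ≤ _
  rw [edist_nndist, ENNReal.coe_le_coe, ← NNReal.coe_le_coe, coe_nndist, hdist]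
  exact hnorm

theorem externalCoveringNumber_l1l2Ball_le [Fintype ι] {r : ℝ} {ε : ℝ≥0} (hε : 0 < ε) {t : ℕ}
    (ht0 : t ≠ 0) (hrt : r ^ 2 ≤ t * ε ^ 2) (ht : t ≤ Fintype.card ι) :
    (externalCoveringNumber ε (l1l2Ball ι r) : ℝ≥0∞) ≤
      ((Fintype.card ι).choose t * (1 + 4 / ε) ^ t : ℝ≥0) := by
  have hε2 : 0 < ε / 2 := half_pos hε
  let B (S : Finset ι) : Set (EuclideanSpace ℝ ι) := supportedOn S ∩ closedBall 0 1
  have hcover : IsCover (ε / 2) (l1l2Ball ι r) (⋃ S ∈ Finset.univ.powersetCard t, B S) :=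
    isCover_l1l2Ball ht0 (by push_cast; linarith) ht
  have hB : ∀ S ∈ Finset.univ.powersetCard t,
      (externalCoveringNumber (ε / 2) (B S) : ℝ≥0∞) ≤ ((1 + 4 / ε) ^ t : ℝ≥0) := fun S hS => by
    calc (externalCoveringNumber (ε / 2) (B S) : ℝ≥0∞)
        ≤ coveringNumber (ε / 2) (B S) :=
          ENat.toENNReal_le.2 (externalCoveringNumber_le_coveringNumber _ _)
      _ ≤ ((1 + 2 * 1 / (ε / 2)) ^ Module.finrank ℝ (supportedOn S) : ℝ≥0) :=
          coveringNumber_submodule_inter_closedBall_le _ hε2 1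
      _ = ((1 + 4 / ε) ^ Module.finrank ℝ (supportedOn S) : ℝ≥0) := by
          congr 3
          field_simp
          norm_num
      _ ≤ ((1 + 4 / ε) ^ t : ℝ≥0) := by
          gcongr
          · exact le_self_add
          · exact (finrank_supportedOn_le S).trans_eq (Finset.mem_powersetCard_univ.1 hS)
  calc (externalCoveringNumber ε (l1l2Ball ι r) : ℝ≥0∞)
      ≤ externalCoveringNumber (ε / 2) (⋃ S ∈ Finset.univ.powersetCard t, B S) := by
        have h := externalCoveringNumber_add_le_of_isCover hcover (ε / 2)
        rw [add_halves] at h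
        exact ENat.toENNReal_le.2 h
    _ ≤ ∑ S ∈ Finset.univ.powersetCard t, (externalCoveringNumber (ε / 2) (B S) : ℝ≥0∞) := by
        have h := externalCoveringNumber_biUnion_le (ε / 2) (Finset.univ.powersetCard t) B
        exact (ENat.toENNReal_le.2 h).trans_eq (map_sum ENat.toENNRealRingHom _ _)
    _ ≤ ((Fintype.card ι).choose t * (1 + 4 / ε) ^ t : ℝ≥0) := by
        refine (Finset.sum_le_card_nsmul _ _ _ hB).trans_eq ?_
        simp [Finset.card_powersetCard]

theorem coveringNumber_le_of_mapsTo_l1l2Ball [Fintype ι] {X : Type*} [EMetricSpace X]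
    {A : X → EuclideanSpace ℝ ι} (hA : Isometry A) {K : Set X} {r : ℝ}
    (hK : Set.MapsTo A K (l1l2Ball ι r)) {ρ : ℝ≥0} (hρ : 0 < ρ) {t : ℕ} (ht0 : t ≠ 0)
    (hrt : 4 * r ^ 2 ≤ t * ρ ^ 2) (ht : t ≤ Fintype.card ι) :
    (coveringNumber ρ K : ℝ≥0∞) ≤ ((Fintype.card ι).choose t * (1 + 8 / ρ) ^ t : ℝ≥0) := by
  have hle : coveringNumber ρ K ≤ externalCoveringNumber (ρ / 2) (l1l2Ball ι r) := by
    calc coveringNumber ρ K = coveringNumber (2 * (ρ / 2)) (A '' K) := by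
          rw [hA.coveringNumber_image, mul_div_cancel₀ _ two_ne_zero]
      _ ≤ externalCoveringNumber (ρ / 2) (A '' K) :=
          coveringNumber_two_mul_le_externalCoveringNumber _ _
      _ ≤ externalCoveringNumber (ρ / 2) (l1l2Ball ι r) :=
          externalCoveringNumber_mono_set hK.image_subset
  refine (ENat.toENNReal_le.2 hle).trans ((externalCoveringNumber_l1l2Ball_le (half_pos hρ) ht0
    (by push_cast; linarith) ht).trans_eq ?_)
  congr 4
  field_simp
  norm_num

end Sparsity

section SupportFunction

variable {E : Type*} [NormedAddCommGroup E] [InnerProductSpace ℝ E] {K : Set E} {R : ℝ≥0}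

/-- The support function `g ↦ sup_{f ∈ K} ⟨f, g⟩` of a set in a real inner product space, with
value `0` when `K` is empty or the supremum is infinite; on `ℝ^n` it is `supInner`. -/
noncomputable def supportFun (K : Set E) (g : E) : ℝ :=
  sSup ((fun f => inner ℝ f g) '' K)

theorem inner_le_mul_norm_of_subset_closedBall (hK : K ⊆ Metric.closedBall 0 R) {f : E}
    (hf : f ∈ K) (g : E) : inner ℝ f g ≤ R * ‖g‖ :=
  (real_inner_le_norm f g).trans
    (mul_le_mul_of_nonneg_right (mem_closedBall_zero_iff.1 (hK hf)) (norm_nonneg g))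

theorem supportFun_zero (K : Set E) : supportFun K 0 = 0 := by
  rcases K.eq_empty_or_nonempty with rfl | hne
  · simp [supportFun]
  · simp [supportFun, hne.image_const]

theorem lipschitzWith_supportFun (hK : K ⊆ Metric.closedBall 0 R) :
    LipschitzWith R (supportFun K) := by
  refine LipschitzWith.of_le_add_mul R fun g g' => ?_
  rcases K.eq_empty_or_nonempty with rfl | hne
  · simp only [supportFun, Set.image_empty, Real.sSup_empty, zero_add]
    positivity
  refine csSup_le (hne.image _) ?_
  rintro _ ⟨f, hf, rfl⟩
  have hbdd : BddAbove ((fun f => inner ℝ f g') '' K) :=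
    ⟨R * ‖g'‖, Set.forall_mem_image.2 fun f hf => inner_le_mul_norm_of_subset_closedBall hK hf g'⟩
  calc inner ℝ f g = inner ℝ f g' + inner ℝ f (g - g') := by rw [inner_sub_right]; ring
    _ ≤ supportFun K g' + R * dist g g' := by
        rw [dist_eq_norm]
        exact add_le_add (le_csSup hbdd ⟨f, hf, rfl⟩)
          (inner_le_mul_norm_of_subset_closedBall hK hf _)

theorem integrable_supportFun [MeasurableSpace E] [OpensMeasurableSpace E] {μ : Measure E}
    (hμ : Integrable id μ) (hK : K ⊆ Metric.closedBall 0 R) : Integrable (supportFun K) μ := by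
  have hlip := lipschitzWith_supportFun hK
  refine (hμ.norm.const_mul R).mono' hlip.continuous.measurable.aestronglyMeasurable
    (.of_forall fun g => ?_)
  simpa [supportFun_zero] using hlip.dist_le_mul g 0

end SupportFunction

section SubGaussian

variable {Ω : Type*} [MeasurableSpace Ω] {μ : Measure Ω} {X : Ω → ℝ} {c : ℝ≥0}

theorem posPart_abs_sub_sq_le {b : ℝ} (hb : 0 < b) (x l : ℝ) :
    (|x| - l)⁺ ^ 2 ≤ 4 / b ^ 2 * Real.exp (-(b * l)) * Real.cosh (b * x) := by
  rcases le_total |x| l with hle | hle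
  · rw [posPart_eq_zero.2 (sub_nonpos.2 hle), zero_pow two_ne_zero]
    have := Real.cosh_pos (b * x)
    positivity
  rw [posPart_eq_self.2 (sub_nonneg.2 hle)]
  have hquad : (b * (|x| - l)) ^ 2 / 2 ≤ Real.exp (b * (|x| - l)) := by
    have hnonneg : 0 ≤ b * (|x| - l) := mul_nonneg hb.le (sub_nonneg.2 hle)
    linarith [Real.quadratic_le_exp_of_nonneg hnonneg]
  have hcosh : Real.exp (b * |x|) ≤ 2 * Real.cosh (b * x) := by
    rw [Real.cosh_eq, ← abs_of_pos hb, ← abs_mul, abs_of_pos hb]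
    linarith [Real.exp_abs_le (b * x)]
  calc (|x| - l) ^ 2 = 2 / b ^ 2 * ((b * (|x| - l)) ^ 2 / 2) := by field_simp
    _ ≤ 2 / b ^ 2 * Real.exp (b * (|x| - l)) := by gcongr
    _ = 2 / b ^ 2 * (Real.exp (-(b * l)) * Real.exp (b * |x|)) := by
        rw [← Real.exp_add]
        ring_nf
    _ ≤ 2 / b ^ 2 * (Real.exp (-(b * l)) * (2 * Real.cosh (b * x))) := by gcongr
    _ = 4 / b ^ 2 * Real.exp (-(b * l)) * Real.cosh (b * x) := by ring

theorem integrable_cosh_mul (hX : HasSubgaussianMGF X c μ) (b : ℝ) :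
    Integrable (fun ω => Real.cosh (b * X ω)) μ := by
  simp only [Real.cosh_eq, ← neg_mul]
  exact ((hX.integrable_exp_mul b).add (hX.integrable_exp_mul (-b))).div_const 2

theorem integral_cosh_mul_le (hX : HasSubgaussianMGF X c μ) (b : ℝ) :
    ∫ ω, Real.cosh (b * X ω) ∂μ ≤ Real.exp (c * b ^ 2 / 2) := by
  simp only [Real.cosh_eq, ← neg_mul]
  rw [integral_div, integral_add (hX.integrable_exp_mul b) (hX.integrable_exp_mul (-b))]
  have hpos := hX.mgf_le b
  have hneg := hX.mgf_le (-b)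
  rw [neg_sq] at hneg
  simp only [mgf] at hpos hneg
  linarith

theorem integrable_posPart_abs_sub_sq [IsFiniteMeasure μ] (hX : HasSubgaussianMGF X c μ) (l : ℝ) :
    Integrable (fun ω => (|X ω| - l)⁺ ^ 2) μ :=
  ((hX.memLp 2).abs.sub (memLp_const l)).pos_part.integrable_sq

theorem integral_posPart_abs_sub_sq_le [IsFiniteMeasure μ] (hX : HasSubgaussianMGF X c μ)
    (hc : 0 < c) {l : ℝ} (hl : 0 < l) :
    ∫ ω, (|X ω| - l)⁺ ^ 2 ∂μ ≤ 4 * c ^ 2 / l ^ 2 * Real.exp (-(l ^ 2 / (2 * c))) := by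
  -- `b = l / c` minimizes the exponent `-(b * l) + c * b ^ 2 / 2`.
  have hb : 0 < l / c := div_pos hl hc
  calc ∫ ω, (|X ω| - l)⁺ ^ 2 ∂μ
      ≤ ∫ ω, 4 / (l / c) ^ 2 * Real.exp (-(l / c * l)) * Real.cosh (l / c * X ω) ∂μ :=
        integral_mono (integrable_posPart_abs_sub_sq hX l)
          ((integrable_cosh_mul hX _).const_mul _) fun ω => posPart_abs_sub_sq_le hb (X ω) l
    _ ≤ 4 / (l / c) ^ 2 * Real.exp (-(l / c * l)) * Real.exp (c * (l / c) ^ 2 / 2) := by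
        rw [integral_const_mul]
        gcongr
        exact integral_cosh_mul_le hX _
    _ = 4 * c ^ 2 / l ^ 2 * Real.exp (-(l ^ 2 / (2 * c))) := by
        have hc' : (c : ℝ) ≠ 0 := NNReal.coe_ne_zero.2 hc.ne'
        have hcoef : 4 / (l / c) ^ 2 = 4 * c ^ 2 / l ^ 2 := by field_simp
        have hexponent : -(l / c * l) + c * (l / c) ^ 2 / 2 = -(l ^ 2 / (2 * c)) := by
          field_simp
          ring
        rw [mul_assoc, ← Real.exp_add, hexponent, hcoef]

end SubGaussian

section GaussianWidth

variable {E : Type*} [NormedAddCommGroup E] [InnerProductSpace ℝ E] {ι : Type*} [Fintype ι]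

theorem inner_le_of_mem_l1l2Ball {r l : ℝ} (hr : 0 < r) (hl : 0 ≤ l) {x : EuclideanSpace ℝ ι}
    (hx : x ∈ l1l2Ball ι r) (h : EuclideanSpace ℝ ι) :
    inner ℝ x h ≤ r * l + r / 2 + (2 * r)⁻¹ * ∑ i, (|h i| - l)⁺ ^ 2 := by
  have hcoord : ∀ i, x i * h i ≤
      |x i| * l + r / 2 * x i ^ 2 + (2 * r)⁻¹ * (|h i| - l)⁺ ^ 2 := fun i => by
    have hamgm : |x i| * (|h i| - l)⁺ ≤ r / 2 * x i ^ 2 + (2 * r)⁻¹ * (|h i| - l)⁺ ^ 2 := by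
      have hsq : 0 ≤ (2 * r)⁻¹ * (r * |x i| - (|h i| - l)⁺) ^ 2 := by positivity
      rw [← sq_abs (x i)]
      field_simp at hsq ⊢
      linarith
    calc x i * h i ≤ |x i| * |h i| := (le_abs_self _).trans_eq (abs_mul _ _)
      _ ≤ |x i| * (l + (|h i| - l)⁺) := by
          gcongr
          linarith [le_posPart (|h i| - l)]
      _ ≤ _ := by linarith
  have hx2 : ∑ i, x i ^ 2 ≤ 1 := by
    rw [← EuclideanSpace.real_norm_sq_eq]
    exact pow_le_one₀ (norm_nonneg _) hx.1
  calc inner ℝ x h = ∑ i, x i * h i := by simp [PiLp.inner_apply, mul_comm]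
    _ ≤ ∑ i, (|x i| * l + r / 2 * x i ^ 2 + (2 * r)⁻¹ * (|h i| - l)⁺ ^ 2) :=
        Finset.sum_le_sum fun i _ => hcoord i
    _ = (∑ i, |x i|) * l + r / 2 * ∑ i, x i ^ 2 + (2 * r)⁻¹ * ∑ i, (|h i| - l)⁺ ^ 2 := by
        simp only [Finset.sum_add_distrib, Finset.sum_mul, Finset.mul_sum]
    _ ≤ r * l + r / 2 * 1 + (2 * r)⁻¹ * ∑ i, (|h i| - l)⁺ ^ 2 := by
        gcongr
        exact hx.2
    _ = _ := by rw [mul_one]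

theorem supportFun_le_of_mapsTo_l1l2Ball (A : E →ₗᵢ[ℝ] EuclideanSpace ℝ ι) {K : Set E} {r l : ℝ}
    (hK : Set.MapsTo A K (l1l2Ball ι r)) (hr : 0 < r) (hl : 0 ≤ l) (g : E) :
    supportFun K g ≤ r * l + r / 2 + (2 * r)⁻¹ * ∑ i, (|A g i| - l)⁺ ^ 2 := by
  refine Real.sSup_le (Set.forall_mem_image.2 fun f hf => ?_) (by positivity)
  rw [← A.inner_map_map]
  exact inner_le_of_mem_l1l2Ball hr hl (hK hf) (A g)

theorem subset_closedBall_of_mapsTo_l1l2Ball (A : E →ₗᵢ[ℝ] EuclideanSpace ℝ ι) {K : Set E} {r : ℝ}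
    (hK : Set.MapsTo A K (l1l2Ball ι r)) : K ⊆ Metric.closedBall 0 1 := fun f hf => by
  simpa using (hK hf).1

variable [MeasurableSpace E] [BorelSpace E]

theorem integral_supportFun_le_of_hasSubgaussianMGF {μ : Measure E} [IsProbabilityMeasure μ]
    (hμ : Integrable id μ) (A : E →ₗᵢ[ℝ] EuclideanSpace ℝ ι) {c : ℝ≥0} (hc : 0 < c)
    (hA : ∀ i, HasSubgaussianMGF (fun g => A g i) c μ) {K : Set E} {r l : ℝ}
    (hK : Set.MapsTo A K (l1l2Ball ι r)) (hr : 0 < r) (hl : 0 < l) :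
    ∫ g, supportFun K g ∂μ ≤ r * l + r / 2 +
      (2 * r)⁻¹ * (Fintype.card ι * (4 * c ^ 2 / l ^ 2 * Real.exp (-(l ^ 2 / (2 * c))))) := by
  have hint : ∀ i, Integrable (fun g => (|A g i| - l)⁺ ^ 2) μ := fun i =>
    integrable_posPart_abs_sub_sq (hA i) l
  have hsum : Integrable (fun g => (2 * r)⁻¹ * ∑ i, (|A g i| - l)⁺ ^ 2) μ :=
    (integrable_finsetSum _ fun i _ => hint i).const_mul _
  calc ∫ g, supportFun K g ∂μ
      ≤ ∫ g, (r * l + r / 2 + (2 * r)⁻¹ * ∑ i, (|A g i| - l)⁺ ^ 2) ∂μ :=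
        integral_mono
          (integrable_supportFun hμ (R := 1) (subset_closedBall_of_mapsTo_l1l2Ball A hK))
          ((integrable_const _).add hsum) (supportFun_le_of_mapsTo_l1l2Ball A hK hr hl.le)
    _ = r * l + r / 2 + (2 * r)⁻¹ * ∑ i, ∫ g, (|A g i| - l)⁺ ^ 2 ∂μ := by
        rw [integral_add (integrable_const _) hsum, integral_const_mul,
          integral_finsetSum _ fun i _ => hint i, integral_const, probReal_univ, one_smul]
    _ ≤ _ := by
        gcongr
        refine (Finset.sum_le_card_nsmul _ _ _ fun i _ =>
          integral_posPart_abs_sub_sq_le (hA i) hc hl).trans_eq ?_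
        rw [nsmul_eq_mul, Finset.card_univ]

variable [FiniteDimensional ℝ E]

theorem hasSubgaussianMGF_stdGaussian {L : StrongDual ℝ E} {c : ℝ≥0} (hL : ‖L‖ ^ 2 ≤ c) :
    HasSubgaussianMGF L c (stdGaussian E) := by
  have hlaw : (stdGaussian E).map L = gaussianReal 0 (‖L‖ ^ 2).toNNReal := by
    rw [IsGaussian.map_eq_gaussianReal L, integral_strongDual_stdGaussian,
      variance_dual_stdGaussian]
  refine ⟨fun b => ?_, fun b => ?_⟩
  · have hint := integrable_exp_mul_gaussianReal (μ := 0) (v := (‖L‖ ^ 2).toNNReal) b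
    rw [← hlaw] at hint
    exact hint.comp_measurable (by fun_prop)
  · rw [mgf_gaussianReal hlaw, Real.coe_toNNReal _ (by positivity), zero_mul, zero_add]
    gcongr

theorem hasSubgaussianMGF_apply_stdGaussian (A : E →ₗᵢ[ℝ] EuclideanSpace ℝ ι) (i : ι) :
    HasSubgaussianMGF (fun g => A g i) 1 (stdGaussian E) := by
  let L : StrongDual ℝ E := (EuclideanSpace.proj i).comp A.toContinuousLinearMap
  have hL : ‖L‖ ≤ 1 := L.opNorm_le_bound zero_le_one fun g => by
    simpa [L] using PiLp.norm_apply_le (A g) i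
  exact hasSubgaussianMGF_stdGaussian (L := L) (by simpa using hL)

theorem integral_supportFun_stdGaussian_le_add (A : E →ₗᵢ[ℝ] EuclideanSpace ℝ ι) {K : Set E}
    {r L : ℝ} (hK : Set.MapsTo A K (l1l2Ball ι r)) (hr : 0 < r) (hL : 0 < L) :
    ∫ g, supportFun K g ∂(stdGaussian E) ≤
      r * √(2 * L) + r / 2 + Fintype.card ι * Real.exp (-L) / (r * L) := by
  refine (integral_supportFun_le_of_hasSubgaussianMGF IsGaussian.integrable_id A one_pos
    (hasSubgaussianMGF_apply_stdGaussian A) hK hr (l := √(2 * L)) (by positivity)).trans_eq ?_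
  rw [Real.sq_sqrt (by positivity), NNReal.coe_one, mul_one, mul_div_cancel_left₀ _ two_ne_zero]
  field_simp
  ring

theorem integral_supportFun_stdGaussian_le (A : E →ₗᵢ[ℝ] EuclideanSpace ℝ ι) {K : Set E} {s : ℝ}
    (hs : 0 < s) (hsN : s ≤ Fintype.card ι) (hK : Set.MapsTo A K (l1l2Ball ι √s)) :
    ∫ g, supportFun K g ∂(stdGaussian E) ≤
      3 * √(s * Real.log (Real.exp 1 * Fintype.card ι / s)) := by
  set N : ℝ := (Fintype.card ι : ℝ)
  have hN : 0 < N := hs.trans_le hsN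
  have hr : 0 < √s := Real.sqrt_pos.2 hs
  set L := Real.log (Real.exp 1 * N / s)
  have hL : 1 ≤ L := by
    rw [Real.le_log_iff_exp_le (by positivity), le_div_iff₀ hs]
    gcongr
  have hexpL : N * Real.exp (-L) = s / Real.exp 1 := by
    rw [Real.exp_neg, Real.exp_log (by positivity)]
    field_simp
  have htail : N * Real.exp (-L) / (√s * L) ≤ √s / 2 := by
    have he : 2 ≤ Real.exp 1 := by linarith [Real.add_one_le_exp (1 : ℝ)]
    calc N * Real.exp (-L) / (√s * L) = √s / (Real.exp 1 * L) := by
          rw [hexpL, div_div, div_eq_div_iff (by positivity) (by positivity)]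
          linear_combination -(Real.exp 1 * L) * Real.mul_self_sqrt hs.le
      _ ≤ √s / 2 := by
          gcongr
          nlinarith
  have hroot : √(2 * L) ≤ 2 * √L := by
    rw [Real.sqrt_mul zero_le_two]
    gcongr
    exact Real.sqrt_le_left (by norm_num) |>.2 (by norm_num)
  calc ∫ g, supportFun K g ∂(stdGaussian E)
      ≤ √s * √(2 * L) + √s / 2 + N * Real.exp (-L) / (√s * L) :=
        integral_supportFun_stdGaussian_le_add A hK hr (by positivity)
    _ ≤ √s * (2 * √L) + √s / 2 + √s / 2 := by gcongr
    _ = 2 * (√s * √L) + √s * 1 := by ring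
    _ ≤ 2 * (√s * √L) + √s * √L := by
        gcongr
        exact Real.one_le_sqrt.2 hL
    _ = 3 * √(s * L) := by
        rw [Real.sqrt_mul hs.le]
        ring

end GaussianWidth

section TightFrame

namespace IsTightFrame

variable {n N : ℕ} {D : Matrix (Fin n) (Fin N) ℝ}

theorem norm_toEuclideanLin_transpose (hD : IsTightFrame D) (f : EuclideanSpace ℝ (Fin n)) :
    ‖Matrix.toEuclideanLin Dᵀ f‖ = ‖f‖ := by
  have hadjoint : Matrix.toEuclideanLin Dᵀ = LinearMap.adjoint (Matrix.toEuclideanLin D) := by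
    rw [← Matrix.toEuclideanLin_conjTranspose_eq_adjoint,
      Matrix.conjTranspose_eq_transpose_of_trivial]
  have hmul : Matrix.toEuclideanLin D (Matrix.toEuclideanLin Dᵀ f) = f := by
    rw [Matrix.toLpLin_apply, Matrix.toLpLin_apply, Matrix.mulVec_mulVec, hD, Matrix.one_mulVec]
  rw [← sq_eq_sq₀ (norm_nonneg _) (norm_nonneg _), ← real_inner_self_eq_norm_sq,
    ← real_inner_self_eq_norm_sq]
  nth_rewrite 1 [hadjoint]
  rw [LinearMap.adjoint_inner_left, hmul]

/-- The analysis operator `f ↦ D* f` of a tight frame, as a linear isometry. -/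
noncomputable def analysis (hD : IsTightFrame D) :
    EuclideanSpace ℝ (Fin n) →ₗᵢ[ℝ] EuclideanSpace ℝ (Fin N) where
  toLinearMap := Matrix.toEuclideanLin Dᵀ
  norm_map' := hD.norm_toEuclideanLin_transpose

theorem mapsTo_analysis_l1l2Ball (hD : IsTightFrame D) (s : ℝ) :
    Set.MapsTo hD.analysis (unitEffAnalysisSparse D s) (l1l2Ball (Fin N) √s) := by
  rintro f ⟨hsparse, hunit⟩
  have hnorm : ‖hD.analysis f‖ = 1 := by rw [hD.analysis.norm_map, mem_sphere_zero_iff_norm.1 hunit]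
  have hl1 : ∑ i, |hD.analysis f i| ≤ √s * ‖hD.analysis f‖ := hsparse
  exact ⟨hnorm.le, by rwa [hnorm, mul_one] at hl1⟩

end IsTightFrame

end TightFrame

theorem mainTheorem9_general {E : Type*} [NormedAddCommGroup E] [InnerProductSpace ℝ E]
    [FiniteDimensional ℝ E] [MeasurableSpace E] [BorelSpace E] {ι : Type*} [Fintype ι]
    (A : E →ₗᵢ[ℝ] EuclideanSpace ℝ ι) {K : Set E} {s : ℝ} (hs : 0 < s)
    (hK : Set.MapsTo A K (l1l2Ball ι √s)) :
    Integrable (supportFun K) (stdGaussian E) ∧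
      (s ≤ Fintype.card ι →
        ∫ g, supportFun K g ∂(stdGaussian E)
          ≤ 3 * √(s * Real.log (Real.exp 1 * Fintype.card ι / s))) ∧
      ∀ (ρ : ℝ≥0) (t : ℕ), 0 < ρ → 4 * ((ρ : ℝ) ^ 2)⁻¹ * s ≤ t → t ≤ Fintype.card ι →
        (Metric.coveringNumber ρ K : ℝ≥0∞)
          ≤ ((Fintype.card ι).choose t : ℝ≥0∞) * (1 + 8 / (ρ : ℝ≥0∞)) ^ t := by
  refine ⟨integrable_supportFun IsGaussian.integrable_id (R := 1)
      (subset_closedBall_of_mapsTo_l1l2Ball A hK),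
    fun hsN => integral_supportFun_stdGaussian_le A hs hsN hK, fun ρ t hρ hst ht => ?_⟩
  have hρ' : (0 : ℝ) < ρ := hρ
  have ht0 : t ≠ 0 := by
    have : (0 : ℝ) < t := lt_of_lt_of_le (by positivity) hst
    exact_mod_cast this.ne'
  have hsρ : 4 * √s ^ 2 ≤ t * (ρ : ℝ) ^ 2 := by
    rw [Real.sq_sqrt hs.le]
    field_simp at hst
    linarith
  have hcov := coveringNumber_le_of_mapsTo_l1l2Ball A.isometry hK hρ ht0 hsρ ht
  push_cast [ENNReal.coe_div hρ.ne'] at hcov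
  exact hcov

theorem mainTheorem9 :
    ∃ C : ℝ, 0 < C ∧
      ∀ (n N : ℕ) (D : Matrix (Fin n) (Fin N) ℝ), IsTightFrame D →
      ∀ s : ℝ, 0 < s →
        (s ≤ N →
          Integrable (supInner (unitEffAnalysisSparse D s))
            (stdGaussian (EuclideanSpace ℝ (Fin n))) ∧
          gaussianWidth (unitEffAnalysisSparse D s)
            ≤ C * √(s * Real.log (Real.exp 1 * N / s))) ∧
        (∀ (ρ : ℝ≥0) (t : ℕ), 0 < ρ → t = ⌈4 * ((ρ : ℝ) ^ 2)⁻¹ * s⌉₊ → t ≤ N →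
          (Metric.coveringNumber ρ (unitEffAnalysisSparse D s) : ℝ≥0∞)
            ≤ (N.choose t : ℝ≥0∞) * (1 + 8 / (ρ : ℝ≥0∞)) ^ t) := by
  refine ⟨3, by norm_num, fun n N D hD s hs => ?_⟩
  obtain ⟨hint, hwidth, hcov⟩ := mainTheorem9_general hD.analysis hs (hD.mapsTo_analysis_l1l2Ball s)
  rw [Fintype.card_fin] at hwidth hcov
  exact ⟨fun hsN => ⟨hint, hwidth hsN⟩,
    fun ρ t hρ ht htN => hcov ρ t hρ (ht ▸ Nat.le_ceil _) htN⟩
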